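/- Let $G=\mathbb{Z}_2*\mathbb{Z}_2*\mathbb{Z}_2$ be the free product of three groups of order two, let $S$ be its standard generating set consisting of the three generators of the free factors, and let $|g|$ be the word length of $g\in G$ with respect to $S$. A regular $k$-gon in $G$ with edge length $\ell$ is a sequence $(g_1,\dots,g_k)$ of $k$ pairwise distinct elements of $G$ such that $|g_1^{-1}g_2|=|g_2^{-1}g_3|=\dots=|g_{k-1}^{-1}g_k|=|g_k^{-1}g_1|=\ell$. Write $a\uparrow b=a^b$, evaluated from right to left, so $a\uparrow b\uparrow c=a^{b^c}$. Theorem. Let $r\ge 1$ and $k\ge 1$ be integers. For every coloring of the elements of $G$ with $r$ colors there is a monochromatic regular $k$-gon in $G$. If moreover $r\ge 2$, then for every positive integer $d$ with $2^{d-1}\ge k$ there is one whose edge length is at most $$\begin{cases}E_r(d), & k \text{ even},\\ O_r(d), & k\text{ odd},\end{cases}$$ where $E_r(d)=4\uparrow 4\uparrow\cdots\uparrow 4\uparrow d$ with exactly $2^{r-2}$ arrows (that is, $2^{r-2}$ fours), and $$O_r(d)=\underbrace{4\uparrow\cdots\uparrow 4\uparrow}_{2^{r-2}-1\text{ arrows}}64\uparrow\underbrace{4\uparrow\cdots\uparrow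 4\uparrow}_{2^{r-3}-1\text{ arrows}}64\uparrow\cdots\uparrow\underbrace{4\uparrow}_{2^{1}-1\text{ arrow}}64\uparrow 64\uparrow d ,$$ i.e. $O_1(d)=d$ and, for $r\ge 2$, $O_r(d)$ is obtained from $64\uparrow O_{r-1}(d)$ by applying the map $x\mapsto 4^x$ exactly $2^{r-2}-1$ times (so $O_2(d)=64\uparrow d$ and $O_3(d)=4\uparrow 64\uparrow 64\uparrow d$). -/

import Mathlib

namespace RegularPolygon

/-- The word length of `g` with respect to `S`: the least length of a word in elements of `S`
and their inverses whose product is `g`. -/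
noncomputable def wordLength {G : Type*} [Group G] (S : Set G) (g : G) : ℕ :=
  sInf {n : ℕ | ∃ w : List G, (∀ s ∈ w, s ∈ S ∨ s⁻¹ ∈ S) ∧ w.prod = g ∧ w.length = n}

/-- The distance `|g⁻¹ h|` of `g` and `h` in the word metric with respect to `S`. -/
noncomputable def wordDist {G : Type*} [Group G] (S : Set G) (g h : G) : ℕ :=
  wordLength S (g⁻¹ * h)

/-- The free product of three copies of the group of order two. -/
abbrev Z2FreeProd : Type := Monoid.CoprodI (fun _ : Fin 3 => Multiplicative (ZMod 2))

/-- The generator of the `i`-th free factor. -/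
def gen (i : Fin 3) : Z2FreeProd :=
  Monoid.CoprodI.of (M := fun _ : Fin 3 => Multiplicative (ZMod 2)) (i := i)
    (Multiplicative.ofAdd 1)

/-- The standard generating set: the three generators of the free factors. -/
def stdGens : Set Z2FreeProd := Set.range gen

/-- Every element is the value of a word in the standard generators, so that `wordLength stdGens`
is the minimum of a nonempty set. -/
theorem exists_word (g : Z2FreeProd) :
    ∃ w : List Z2FreeProd, (∀ s ∈ w, s ∈ stdGens ∨ s⁻¹ ∈ stdGens) ∧ w.prod = g := by
  induction g using Monoid.CoprodI.induction_on with
  | one => exact ⟨[], by simp, by simp⟩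
  | of i m =>
    have hm : m = 1 ∨ m = Multiplicative.ofAdd (1 : ZMod 2) := by
      revert m; decide
    rcases hm with rfl | rfl
    · exact ⟨[], by simp, by simp⟩
    · exact ⟨[gen i], by simp [stdGens], by simp [gen]⟩
  | mul x y hx hy =>
    obtain ⟨u, hu, rfl⟩ := hx
    obtain ⟨v, hv, rfl⟩ := hy
    refine ⟨u ++ v, ?_, by simp⟩
    intro s hs
    rcases List.mem_append.mp hs with h | h
    · exact hu s h
    · exact hv s h

/-- `(g₀, …, g_{k-1})` is a regular `k`-gon with edge length `l`: the vertices are pairwise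
distinct, and cyclically consecutive ones (`finRotate k` sends `i` to `i + 1` and the last index
to the first) are at word distance `l`. -/
def IsRegularPolygon {G : Type*} [Group G] (S : Set G) (k : ℕ) (g : Fin k → G) (l : ℕ) : Prop :=
  Function.Injective g ∧ ∀ i : Fin k, wordDist S (g i) (g (finRotate k i)) = l

/-- `tower n x = 4 ↑ 4 ↑ ⋯ ↑ 4 ↑ x` with `n` fours (hence `n` arrows). -/
def tower : ℕ → ℕ → ℕ
  | 0, x => x
  | n + 1, x => 4 ^ tower n x

/-- The bound for even `k` (for `r ≥ 2` colors): `4 ↑ ⋯ ↑ 4 ↑ d` with `2 ^ (r - 2)` arrows. -/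
def evenBound (r d : ℕ) : ℕ := tower (2 ^ (r - 2)) d

/-- The bound for odd `k` (for `r ≥ 2` colors): the block of `2 ^ (j - 2) - 1` fours and one `64`,
for `j = r, r - 1, …, 2` from left to right, followed by `d`. Thus it is `64 ↑ d` for `r = 2`
and `4 ↑ 64 ↑ 64 ↑ d` for `r = 3`. -/
def oddBound : ℕ → ℕ → ℕ
  | 0, d => d
  | 1, d => d
  | j + 2, d => tower (2 ^ j - 1) (64 ^ oddBound (j + 1) d)

end RegularPolygon

namespace RegularPolygon

open Monoid.CoprodI

/-! The Cayley graph contains a rooted binary tree in which nodes branching at `p` have distance the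
sum of their heights above `p`. If many nodes of one colour at depth `N` lie below each child of
`p`, the two families are completely joined at distance `2 * (N - p.length)`, and alternating
between them gives every short even cycle. Such a fork exists by pigeonhole (`exists_forked`).

An odd cycle needs one more point of that colour, equidistant from both families. `exists_fan` finds
it by induction on the number of colours: on some deep subtree a fixed colour `i` and a fixed fork
depth occur below every node. A node of colour `i` at a suitable level is then the missing point for
a fork on a neighbouring branch. If there is none, `i` is absent from the even levels of a whole
subtree, and one colour fewer remains.

The depths obtained are linear in `r` and `d` for even `k` and follow the recursion `fanDepth` for
odd `k`, so the towers bound them generously. -/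

/-! ### Word length in the free product -/

/-- The length of the normal form of an element of the free product. -/
def normalLength (g : Z2FreeProd) : ℕ :=
  (Word.equiv g).toList.length

/-- A generator changes only the head of the normal form, and the remaining tail is no longer than
the whole word. -/
theorem normalLength_gen_mul_le (i : Fin 3) (g : Z2FreeProd) :
    normalLength (gen i * g) ≤ normalLength g + 1 := by
  set w := Word.equiv g with hw
  have h1 : Word.equiv (gen i * g) = Word.rcons
      { Word.equivPair i w with head := Multiplicative.ofAdd 1 * (Word.equivPair i w).head } := by
    have h : Word.equiv (gen i * g) = gen i • Word.equiv g :=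
      mul_smul (gen i) g (Word.empty : Word fun _ : Fin 3 => Multiplicative (ZMod 2))
    rw [h, ← hw]
    exact Word.of_smul_def i w _
  have h2 : w = Word.rcons (Word.equivPair i w) := ((Word.equivPair i).symm_apply_apply w).symm
  have h3 : (Word.equivPair i w).tail.toList.length ≤ w.toList.length := by
    conv_rhs => rw [h2]
    unfold Word.rcons
    split_ifs <;> simp
  unfold normalLength
  rw [h1, ← hw]
  refine le_trans ?_ (Nat.succ_le_succ h3)
  unfold Word.rcons
  split_ifs <;> simp

theorem gen_inv (i : Fin 3) : (gen i)⁻¹ = gen i := by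
  rw [gen, ← map_inv]
  congr 1

theorem normalLength_prod_le (w : List Z2FreeProd)
    (hw : ∀ s ∈ w, s ∈ stdGens ∨ s⁻¹ ∈ stdGens) : normalLength w.prod ≤ w.length := by
  induction w with
  | nil =>
    have h : Word.equiv (1 : Z2FreeProd) = Word.empty := one_smul Z2FreeProd _
    simp [normalLength, h, Word.empty]
  | cons s w ih =>
    have hs : s ∈ stdGens := by
      rcases hw s (by simp) with h | ⟨i, h⟩
      · exact h
      · exact ⟨i, by rw [← gen_inv, h, inv_inv]⟩
    obtain ⟨i, rfl⟩ := hs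
    have := ih fun s h => hw s (by simp [h])
    have := normalLength_gen_mul_le i w.prod
    simp only [List.prod_cons, List.length_cons]
    omega

/-- A word without adjacent equal letters is its own normal form. -/
theorem normalLength_prod_of_isChain (l : List (Fin 3)) (hl : l.IsChain (· ≠ ·)) :
    normalLength (l.map gen).prod = l.length := by
  let w : Word (fun _ : Fin 3 => Multiplicative (ZMod 2)) :=
    { toList := l.map fun i => ⟨i, Multiplicative.ofAdd 1⟩
      ne_one := by
        intro x hx
        obtain ⟨i, -, rfl⟩ := List.mem_map.mp hx
        exact (by decide : Multiplicative.ofAdd (1 : ZMod 2) ≠ 1)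
      chain_ne := by
        rw [List.isChain_map]
        exact hl }
  have h : (l.map gen).prod = w.prod := by
    rw [Word.prod, List.map_map]
    rfl
  rw [h, normalLength]
  change (Word.equiv (Word.equiv.symm w)).toList.length = _
  simp [w]

theorem wordLength_prod_of_isChain (l : List (Fin 3)) (hl : l.IsChain (· ≠ ·)) :
    wordLength stdGens (l.map gen).prod = l.length := by
  have hmem : l.length ∈ {n : ℕ | ∃ w : List Z2FreeProd,
      (∀ s ∈ w, s ∈ stdGens ∨ s⁻¹ ∈ stdGens) ∧ w.prod = (l.map gen).prod ∧ w.length = n} :=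
    ⟨l.map gen, fun s hs => by
      obtain ⟨i, -, rfl⟩ := List.mem_map.mp hs
      exact Or.inl ⟨i, rfl⟩, rfl, by simp⟩
  refine le_antisymm (Nat.sInf_le hmem) (le_csInf ⟨_, hmem⟩ ?_)
  rintro n ⟨w, hw, hprod, rfl⟩
  rw [← normalLength_prod_of_isChain l hl, ← hprod]
  exact normalLength_prod_le w hw

theorem wordDist_self (g : Z2FreeProd) : wordDist stdGens g g = 0 := by
  simpa [wordDist] using wordLength_prod_of_isChain [] List.isChain_nil

theorem wordLength_inv_le {G : Type*} [Group G] (S : Set G) (g : G)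
    (hg : ∃ w : List G, (∀ s ∈ w, s ∈ S ∨ s⁻¹ ∈ S) ∧ w.prod = g) :
    wordLength S g⁻¹ ≤ wordLength S g := by
  obtain ⟨v, hv, hvg⟩ := hg
  refine le_csInf ⟨_, v, hv, hvg, rfl⟩ ?_
  rintro n ⟨w, hw, rfl, rfl⟩
  refine Nat.sInf_le ⟨(w.map (·⁻¹)).reverse, ?_, ?_, by simp⟩
  · intro s hs
    obtain ⟨t, ht, rfl⟩ := List.mem_map.mp (List.mem_reverse.mp hs)
    simpa [or_comm] using hw t ht
  · rw [List.prod_inv_reverse]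

theorem wordDist_comm (g h : Z2FreeProd) :
    wordDist stdGens g h = wordDist stdGens h g := by
  have key (x y : Z2FreeProd) : wordDist stdGens x y ≤ wordDist stdGens y x := by
    have h : x⁻¹ * y = (y⁻¹ * x)⁻¹ := by group
    rw [wordDist, h]
    exact wordLength_inv_le _ _ (exists_word _)
  exact le_antisymm (key g h) (key h g)

/-! ### The binary tree inside the Cayley graph -/

/-- The letter other than `a` selected by `b`. -/
def nextLetter (a : Fin 3) (b : Bool) : Fin 3 :=
  if b then a + 1 else a + 2

theorem ne_nextLetter : ∀ (a : Fin 3) (b : Bool), a ≠ nextLetter a b := by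
  decide

theorem nextLetter_not : ∀ (a : Fin 3) (b : Bool), nextLetter a b ≠ nextLetter a (!b) := by
  decide

/-- The reduced word that follows the letter `a` along a path in the binary tree. -/
def pathWord : Fin 3 → List Bool → List (Fin 3)
  | _, [] => []
  | a, b :: l => nextLetter a b :: pathWord (nextLetter a b) l

theorem length_pathWord (a : Fin 3) (l : List Bool) : (pathWord a l).length = l.length := by
  induction l generalizing a with
  | nil => rfl
  | cons b l ih => simp [pathWord, ih]

theorem isChain_cons_pathWord (a : Fin 3) (l : List Bool) :
    (a :: pathWord a l).IsChain (· ≠ ·) := by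
  induction l generalizing a with
  | nil => simp [pathWord]
  | cons b l ih =>
    rw [pathWord, List.isChain_cons_cons]
    exact ⟨ne_nextLetter a b, ih _⟩

/-- The embedding of the rooted binary tree into the Cayley graph of the free product. -/
def embed (l : List Bool) : Z2FreeProd :=
  ((pathWord 0 l).map gen).prod

theorem prod_pathWord_append (a : Fin 3) (p l : List Bool) :
    ((pathWord a (p ++ l)).map gen).prod = ((pathWord a p).map gen).prod *
      ((pathWord (p.foldl nextLetter a) l).map gen).prod := by
  induction p generalizing a with
  | nil => simp [pathWord]
  | cons b p ih => simp [pathWord, ih, mul_assoc]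

theorem inv_prod_map_gen (l : List (Fin 3)) :
    ((l.map gen).prod)⁻¹ = (l.reverse.map gen).prod := by
  induction l with
  | nil => simp
  | cons i l ih => simp [ih, gen_inv]

/-- Two nodes on different branches at `p` are at distance the sum of their heights below `p`. -/
theorem wordDist_embed (p u v : List Bool) (b : Bool) :
    wordDist stdGens (embed (p ++ b :: u)) (embed (p ++ (!b) :: v)) =
      u.length + v.length + 2 := by
  set a := p.foldl nextLetter 0 with ha
  have h : (embed (p ++ b :: u))⁻¹ * embed (p ++ (!b) :: v) =
      (((pathWord a (b :: u)).reverse ++ pathWord a ((!b) :: v)).map gen).prod := by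
    rw [embed, embed, prod_pathWord_append, prod_pathWord_append, mul_inv_rev, ← ha,
      List.map_append, List.prod_append, inv_prod_map_gen]
    group
  rw [wordDist, h, wordLength_prod_of_isChain]
  · simp [length_pathWord]
    omega
  · rw [List.isChain_append]
    refine ⟨?_, (isChain_cons_pathWord a ((!b) :: v)).tail, ?_⟩
    · rw [List.isChain_reverse]
      exact (isChain_cons_pathWord a (b :: u)).tail.imp fun _ _ h => Ne.symm h
    · intro x hx y hy
      simp only [pathWord, List.getLast?_reverse, List.head?_cons, Option.mem_some_iff] at hx hy
      rw [← hx, ← hy]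
      exact nextLetter_not a b

/-! ### Forks and fans in coloured binary trees -/

section Tree

variable {α : Type*}

/-- At least `K` descendants of `x` at depth `N` have colour `i`. -/
def Rich (color : List Bool → α) (K N : ℕ) (x : List Bool) (i : α) : Prop :=
  ∃ A : Finset (List Bool), K ≤ A.card ∧ ∀ a ∈ A, x <+: a ∧ a.length = N ∧ color a = i

/-- Both children of `p` have at least `K` descendants of colour `i` at depth `N`. -/
def Forked (color : List Bool → α) (K N : ℕ) (p : List Bool) (i : α) : Prop :=
  Rich color K N (p ++ [true]) i ∧ Rich color K N (p ++ [false]) i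

/-- A forked node `p` together with a node of the same colour that branches off above `p` and
whose distance to `p` is that of the coloured descendants of `p`; these are at distance at most
`D` from each other. -/
def HasFan (color : List Bool → α) (K D : ℕ) : Prop :=
  ∃ (i : α) (N : ℕ) (p z : List Bool) (b : Bool) (q : List Bool),
    Forked color K N p i ∧ color (z ++ b :: q) = i ∧ z ++ [!b] <+: p ∧
      q.length + 1 + 2 * p.length = N + z.length ∧ 2 * N ≤ D + 2 * p.length

theorem Rich.of_prefix {color : List Bool → α} {K N : ℕ} {x y : List Bool} {i : α}
    (h : Rich color K N y i) (hxy : x <+: y) : Rich color K N x i := by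
  obtain ⟨A, hA, h⟩ := h
  exact ⟨A, hA, fun a ha => ⟨hxy.trans (h a ha).1, (h a ha).2⟩⟩

theorem Rich.of_subtree {color : List Bool → α} {K N : ℕ} {x y : List Bool} {i : α}
    (h : Rich (fun l => color (y ++ l)) K N x i) : Rich color K (y.length + N) (y ++ x) i := by
  classical
  obtain ⟨A, hA, h⟩ := h
  refine ⟨A.image (y ++ ·), ?_, ?_⟩
  · rwa [Finset.card_image_of_injective _ (List.append_right_injective y)]
  · intro a ha
    obtain ⟨l, hl, rfl⟩ := Finset.mem_image.mp ha
    obtain ⟨h1, h2, h3⟩ := h l hl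
    exact ⟨(List.prefix_append_right_inj y).mpr h1, by simp [h2], h3⟩

theorem HasFan.of_subtree {color : List Bool → α} {K D : ℕ} {y : List Bool}
    (h : HasFan (fun l => color (y ++ l)) K D) : HasFan color K D := by
  obtain ⟨i, N, p, z, b, q, ⟨hp₁, hp₂⟩, hc, hz, hl, hD⟩ := h
  refine ⟨i, y.length + N, y ++ p, y ++ z, b, q, ⟨?_, ?_⟩, ?_, ?_, ?_, ?_⟩
  · simpa using hp₁.of_subtree
  · simpa using hp₂.of_subtree
  · simpa using hc
  · simpa [List.append_assoc] using hz
  · simp only [List.length_append]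
    omega
  · simp only [List.length_append]
    omega

theorem HasFan.mono {color : List Bool → α} {K D D' : ℕ} (h : HasFan color K D) (hD : D ≤ D') :
    HasFan color K D' := by
  obtain ⟨i, N, p, z, b, q, h₁, h₂, h₃, h₄, h₅⟩ := h
  exact ⟨i, N, p, z, b, q, h₁, h₂, h₃, h₄, by omega⟩

/-- Pigeonhole: `x` has at least `2 ^ e` descendants at depth `N`, coloured from `S`. -/
theorem exists_rich {color : List Bool → α} {K N e : ℕ} {S : Finset α}
    (hS : ∀ a, a.length = N → color a ∈ S) (hK : S.card * K ≤ 2 ^ e) {x : List Bool}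
    (hx : x.length + e ≤ N) : ∃ i ∈ S, Rich color K N x i := by
  classical
  let f : (Fin (N - x.length) → Bool) → List Bool := fun v => x ++ List.ofFn v
  have hf : Function.Injective f :=
    (List.append_right_injective x).comp List.ofFn_injective
  have hlen (v) : (f v).length = N := by
    simp only [f, List.length_append, List.length_ofFn]
    omega
  have hcard : S.card * K ≤ (Finset.univ.image f).card := by
    rw [Finset.card_image_of_injective _ hf]
    simp only [Finset.card_univ, Fintype.card_fun, Fintype.card_bool, Fintype.card_fin]
    exact hK.trans (Nat.pow_le_pow_right (by norm_num) (by omega))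
  have hmaps : ∀ a ∈ Finset.univ.image f, color a ∈ S := by
    intro a ha
    obtain ⟨v, -, rfl⟩ := Finset.mem_image.mp ha
    exact hS _ (hlen v)
  obtain ⟨i, hi, h⟩ := Finset.exists_le_card_fiber_of_mul_le_card_of_maps_to hmaps
    ⟨_, hS (f fun _ => true) (hlen _)⟩ hcard
  refine ⟨i, hi, _, h, fun a ha => ?_⟩
  obtain ⟨ha, hc⟩ := Finset.mem_filter.mp ha
  obtain ⟨v, -, rfl⟩ := Finset.mem_image.mp ha
  exact ⟨List.prefix_append _ _, hlen v, hc⟩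

open Classical in
-- If no colour forks at `x`, a colour rich at one child is not rich at the other, so stepping to
-- the latter loses a rich colour. By `exists_rich` they never run out.
theorem exists_forked_of_card_le {color : List Bool → α} {K N e : ℕ} {S : Finset α}
    (hS : ∀ a, a.length = N → color a ∈ S) (hK : S.card * K ≤ 2 ^ e) (n : ℕ) (x : List Bool)
    (hx : x.length + n + e ≤ N) (hn : (S.filter (Rich color K N x)).card ≤ n) :
    ∃ p, ∃ i ∈ S, x <+: p ∧ p.length < x.length + n ∧ Forked color K N p i := by
  induction n generalizing x with
  | zero =>
    obtain ⟨i, hi, h⟩ := exists_rich hS hK (x := x) (by omega)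
    have : i ∈ S.filter (Rich color K N x) := Finset.mem_filter.mpr ⟨hi, h⟩
    rw [Finset.card_eq_zero.mp (Nat.le_zero.mp hn)] at this
    simp at this
  | succ n ih =>
    by_cases hc : ∃ i ∈ S, Forked color K N x i
    · obtain ⟨i, hi, h⟩ := hc
      exact ⟨x, i, hi, List.prefix_rfl, by omega, h⟩
    · push Not at hc
      obtain ⟨i, hi, h⟩ := exists_rich hS hK (x := x ++ [true]) (by simp; omega)
      have hlt : S.filter (Rich color K N (x ++ [false])) ⊂ S.filter (Rich color K N x) := by
        refine Finset.ssubset_iff_subset_ne.mpr ⟨?_, fun heq => ?_⟩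
        · exact Finset.monotone_filter_right _ fun j _ hj => hj.of_prefix (List.prefix_append _ _)
        · have hix : i ∈ S.filter (Rich color K N x) :=
            Finset.mem_filter.mpr ⟨hi, h.of_prefix (List.prefix_append _ _)⟩
          rw [← heq] at hix
          exact hc i hi ⟨h, (Finset.mem_filter.mp hix).2⟩
      have hlt := Finset.card_lt_card hlt
      obtain ⟨p, i, hi, hp, hlen, hf⟩ := ih (x ++ [false]) (by simp; omega) (by omega)
      refine ⟨p, i, hi, (List.prefix_append _ _).trans hp, ?_, hf⟩
      simp at hlen
      omega

theorem exists_forked {color : List Bool → α} {K N e : ℕ} {S : Finset α}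
    (hS : ∀ a, a.length = N → color a ∈ S) (hK : S.card * K ≤ 2 ^ e) (x : List Bool)
    (hx : x.length + S.card + e ≤ N) :
    ∃ p, ∃ i ∈ S, x <+: p ∧ p.length < x.length + S.card ∧ Forked color K N p i := by
  classical
  exact exists_forked_of_card_le hS hK _ x hx (Finset.card_filter_le _ _)

/-- An antitone family of nonempty finite sets on a deep tree has an element that is common to all
members on a subtree of depth `H`. -/
theorem exists_stable {β : Type*} {C : List Bool → Finset β} {L H : ℕ}
    (hC : ∀ y z, y <+: z → C z ⊆ C y) (hne : ∀ y, y.length ≤ L → (C y).Nonempty)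
    (n : ℕ) (y : List Bool) (hn : (C y).card ≤ n) (hy : y.length + n * H ≤ L) :
    ∃ x, x.length + H ≤ L ∧ ∃ c, ∀ z, x <+: z → z.length ≤ x.length + H → c ∈ C z := by
  induction n generalizing y with
  | zero =>
    have := Finset.card_pos.mpr (hne y (by omega))
    omega
  | succ n ih =>
    have hmul : (n + 1) * H = n * H + H := by ring
    -- Either nothing is lost within `H` levels below `y`, or some `z` there has a strictly smaller
    -- set and the search restarts at `z`.
    by_cases h : ∀ z, y <+: z → z.length ≤ y.length + H → C y ⊆ C z
    · obtain ⟨c, hc⟩ := hne y (by omega)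
      exact ⟨y, by omega, c, fun z h₁ h₂ => h z h₁ h₂ hc⟩
    · push Not at h
      obtain ⟨z, h₁, h₂, h₃⟩ := h
      have := Finset.card_lt_card (Finset.ssubset_iff_subset_ne.mpr
        ⟨hC y z h₁, fun he => h₃ he.ge⟩)
      exact ih z (by omega) (by omega)

/-- Half the depth of a tree in which `R` colours on the even levels force a fan. -/
def fanDepth (d : ℕ) : ℕ → ℕ
  | 0 => 1
  | R + 1 => (R + 1) ^ 2 * fanDepth d R + 2 * (R + 1) + d + 1

theorem exists_fan {K d : ℕ} (hK : K ≤ 2 ^ d) (R : ℕ) (S : Finset α) (color : List Bool → α)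
    (hR : S.card = R) (hS : ∀ x : List Bool, Even x.length → x.length < 2 * fanDepth d R →
      color x ∈ S) : HasFan color K (4 * fanDepth d R) := by
  classical
  induction R generalizing S color with
  | zero =>
    have := hS [] (by simp) (by simp [fanDepth])
    simp [Finset.card_eq_zero.mp hR] at this
  | succ R ih =>
    set H := fanDepth d R with hH
    set L := (R + 1) ^ 2 * H with hL
    -- The bracket is the depth `exists_forked` needs from level `L`. Doubling makes `N` even, so
    -- `S` contains the colours at depth `N`, and makes `N > 2 * (L + s)` for every offset `s ≤ R`.
    set N := 2 * (L + (R + 1) + (R + 1 + d)) with hN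
    have hF : fanDepth d (R + 1) = L + 2 * (R + 1) + d + 1 := rfl
    rw [hF] at hS ⊢
    have hHL : H ≤ L := Nat.le_mul_of_pos_left _ (by positivity)
    have hSN : ∀ a, a.length = N → color a ∈ S := fun a ha =>
      hS a (by rw [ha]; exact even_two_mul _) (by omega)
    have hcard : S.card * K ≤ 2 ^ (R + 1 + d) := by
      rw [hR, pow_add]
      exact Nat.mul_le_mul Nat.lt_two_pow_self.le hK
    -- The possible types (colour, depth offset) of a fork below `y`; there are at most `(R + 1) ^
    -- 2`, whence the factor in `L`.
    let C : List Bool → Finset (α × ℕ) := fun y => (S ×ˢ Finset.range (R + 1)).filter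
      fun c => ∃ p, y <+: p ∧ p.length = L + c.2 ∧ Forked color K N p c.1
    have hC : ∀ y z, y <+: z → C z ⊆ C y := fun y z hyz =>
      Finset.monotone_filter_right _ fun c _ ⟨p, h₁, h₂⟩ => ⟨p, hyz.trans h₁, h₂⟩
    have hne : ∀ y, y.length ≤ L → (C y).Nonempty := by
      intro y hy
      have hlen : (y ++ List.replicate (L - y.length) true).length = L := by
        simp
        omega
      obtain ⟨p, i, hi, h₁, h₂, h₃⟩ := exists_forked hSN hcard
        (y ++ List.replicate (L - y.length) true) (by omega)
      have h₄ := h₁.length_le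
      rw [hlen] at h₂ h₄
      refine ⟨(i, p.length - L), Finset.mem_filter.mpr ⟨Finset.mem_product.mpr
        ⟨hi, Finset.mem_range.mpr (by dsimp only; omega)⟩, p, (List.prefix_append _ _).trans h₁,
        by dsimp only; omega, h₃⟩⟩
    obtain ⟨y, hy, ⟨i, s⟩, hstable⟩ := exists_stable (H := H) hC hne ((R + 1) ^ 2) []
      ((Finset.card_filter_le _ _).trans (by simp [hR, sq])) (by simp [hL])
    have hmem := hstable y List.prefix_rfl (by omega)
    simp only [C, Finset.mem_filter, Finset.mem_product, Finset.mem_range] at hmem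
    obtain ⟨⟨hi, hs⟩, -⟩ := hmem
    by_contra hfan
    -- Let `z` be the prefix of `q` of length `y.length + h`. By stability a fork of type `(i, s)`
    -- lies below the child of `z` off the path to `q`; the length of `q` is the one that balances
    -- the distances, so colour `i` would give a fan.
    have havoid : ∀ q h, y <+: q → h < H → q.length = N - 2 * (L + s) + 2 * (y.length + h) →
        color q ≠ i := by
      intro q h hyq hh hq hc
      apply hfan
      have hlt : y.length + h < q.length := by omega
      have hsplit : q = q.take (y.length + h) ++ q[y.length + h] :: q.drop (y.length + h + 1) := by
        simp
      set z := q.take (y.length + h) with hz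
      set b := q[y.length + h]
      set q' := q.drop (y.length + h + 1) with hq'
      have hzl : z.length = y.length + h := by
        rw [hz, List.length_take]
        omega
      have hyz : y <+: z := by
        rw [hz]
        exact List.prefix_take_iff.mpr ⟨hyq, by omega⟩
      have hm := hstable (z ++ [!b]) (hyz.trans (List.prefix_append _ _)) (by simp; omega)
      simp only [C, Finset.mem_filter] at hm
      obtain ⟨-, p, hp, hpl, hpf⟩ := hm
      have hq'l : q'.length = q.length - (y.length + h + 1) := by simp [hq']
      exact ⟨i, N, p, z, b, q', hpf, by rw [← hsplit]; exact hc, hp, by omega, by omega⟩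
    -- At this depth the level `2 * h` of the subtree at `w` is the level that `havoid` treats for
    -- `h`.
    set w := y ++ List.replicate (N - 2 * (L + s) + y.length) true with hw
    have hwl : w.length = N - 2 * (L + s) + 2 * y.length := by
      simp [hw]
      omega
    refine hfan (HasFan.mono (HasFan.of_subtree (y := w) (ih (S.erase i) _ ?_ ?_)) (by omega))
    · rw [Finset.card_erase_of_mem hi, hR]
      rfl
    · rintro x ⟨h, hx⟩ hxl
      have hl : (w ++ x).length = N - 2 * (L + s) + 2 * (y.length + h) := by
        simp only [List.length_append]
        omega
      refine Finset.mem_erase.mpr ⟨havoid _ h ?_ (by omega) hl, hS _ ?_ (by omega)⟩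
      · rw [hw, List.append_assoc]
        exact List.prefix_append _ _
      · rw [hl]
        exact ⟨N / 2 - (L + s) + (y.length + h), by omega⟩

end Tree

/-! ### Cycles in complete bipartite relations -/

section Cycle

variable {X : Type*}

theorem exists_injOn_lt_of_le_card {K : ℕ} {A : Finset X} (hA : K ≤ A.card) (x : X) :
    ∃ a : ℕ → X, (∀ j < K, a j ∈ A) ∧ ∀ i < K, ∀ j < K, a i = a j → i = j := by
  obtain ⟨f⟩ : Nonempty (Fin K ↪ A) := Function.Embedding.nonempty_of_card_le (by simpa using hA)
  refine ⟨fun j => if h : j < K then f ⟨j, h⟩ else x, fun j hj => by simp [hj], ?_⟩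
  intro i hi j hj h
  simpa [hi, hj] using h

theorem val_finRotate {k : ℕ} (i : Fin k) :
    (finRotate k i : ℕ) = if (i : ℕ) + 1 = k then 0 else (i : ℕ) + 1 := by
  obtain _ | n := k
  · exact i.elim0
  · rw [coe_finRotate]
    simp [Fin.ext_iff]

/-- Two sets that are completely joined by a relation, together with a point joined to both if
`k` is odd, contain a cycle of length `k`. -/
theorem exists_cycle {R : X → X → Prop} (hsymm : ∀ x y, R x y → R y x) (hirr : ∀ x, ¬ R x x)
    {k : ℕ} (hk : 2 ≤ k) {A B : Finset X} (hA : k / 2 ≤ A.card) (hB : k / 2 ≤ B.card)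
    (hAB : ∀ a ∈ A, ∀ b ∈ B, R a b) (q : X)
    (hq : Odd k → (∀ a ∈ A, R a q) ∧ ∀ b ∈ B, R b q) :
    ∃ g : Fin k → X, Function.Injective g ∧ (∀ i, R (g i) (g (finRotate k i))) ∧
      ∀ i, g i ∈ A ∨ g i ∈ B ∨ (Odd k ∧ g i = q) := by
  obtain ⟨a, ha, hainj⟩ := exists_injOn_lt_of_le_card hA q
  obtain ⟨b, hb, hbinj⟩ := exists_injOn_lt_of_le_card hB q
  have hab : ∀ i < k / 2, ∀ j < k / 2, R (a i) (b j) := fun i hi j hj =>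
    hAB _ (ha i hi) _ (hb j hj)
  have hne : ∀ x y, R x y → x ≠ y := fun x y h e => hirr y (e ▸ h)
  have hodd : ∀ n < k, 2 * (k / 2) ≤ n → Odd k ∧ n + 1 = k := fun n _ _ =>
    ⟨⟨k / 2, by omega⟩, by omega⟩
  -- The cycle is `a 0, b 0, a 1, b 1, …`; below `k` the value `q` occurs only at the last index,
  -- for odd `k`.
  let f : ℕ → X := fun n => if 2 * (k / 2) ≤ n then q else
    if n % 2 = 0 then a (n / 2) else b (n / 2)
  have hfq : ∀ n, 2 * (k / 2) ≤ n → f n = q := fun n h => if_pos h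
  have hfa : ∀ n, n < 2 * (k / 2) → n % 2 = 0 → f n = a (n / 2) := fun n h h' => by
    simp [f, h.not_ge, h']
  have hfb : ∀ n, n < 2 * (k / 2) → n % 2 = 1 → f n = b (n / 2) := fun n h h' => by
    simp [f, h.not_ge, h']
  have hfR : ∀ m < k, ∀ n < k, m % 2 = 0 → m < 2 * (k / 2) →
      n % 2 = 1 ∨ 2 * (k / 2) ≤ n → R (f m) (f n) := by
    intro m hm n hn hm2 hmk h
    rw [hfa m hmk hm2]
    by_cases hnk : 2 * (k / 2) ≤ n
    · rw [hfq n hnk]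
      exact (hq (hodd n hn hnk).1).1 _ (ha _ (by omega))
    · rw [hfb n (by omega) (by omega)]
      exact hab _ (by omega) _ (by omega)
  have hfR' : ∀ m < k, ∀ n < k, m % 2 = 1 → m < 2 * (k / 2) → 2 * (k / 2) ≤ n →
      R (f m) (f n) := by
    intro m hm n hn hm2 hmk hnk
    rw [hfb m hmk hm2, hfq n hnk]
    exact (hq (hodd n hn hnk).1).2 _ (hb _ (by omega))
  have hinj : ∀ m < k, ∀ n < k, m < n → f m ≠ f n := by
    intro m hm n hn hmn
    rcases Nat.mod_two_eq_zero_or_one m with hm2 | hm2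
    · by_cases h : n % 2 = 1 ∨ 2 * (k / 2) ≤ n
      · exact hne _ _ (hfR m hm n hn hm2 (by omega) h)
      · rw [hfa m (by omega) hm2, hfa n (by omega) (by omega)]
        intro h
        have := hainj _ (by omega) _ (by omega) h
        omega
    · by_cases h : 2 * (k / 2) ≤ n
      · exact hne _ _ (hfR' m hm n hn hm2 (by omega) h)
      · rcases Nat.mod_two_eq_zero_or_one n with hn2 | hn2
        · exact (hne _ _ (hfR n hn m hm hn2 (by omega) (Or.inl hm2))).symm
        · rw [hfb m (by omega) hm2, hfb n (by omega) hn2]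
          intro h
          have := hbinj _ (by omega) _ (by omega) h
          omega
  refine ⟨fun i => f i, ?_, ?_, ?_⟩
  · intro i j h
    rcases lt_trichotomy (i : ℕ) j with hij | hij | hij
    · exact absurd h (hinj _ i.2 _ j.2 hij)
    · exact Fin.ext hij
    · exact absurd h.symm (hinj _ j.2 _ i.2 hij)
  · intro i
    obtain ⟨n, hn⟩ := i
    dsimp only
    rw [val_finRotate]
    dsimp only
    split_ifs with h
    · refine hsymm _ _ (hfR 0 (by omega) n hn rfl (by omega) (by omega))
    · rcases Nat.mod_two_eq_zero_or_one n with hn2 | hn2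
      · exact hfR n hn (n + 1) (by omega) hn2 (by omega) (by omega)
      · by_cases h' : 2 * (k / 2) ≤ n + 1
        · exact hfR' n hn (n + 1) (by omega) hn2 (by omega) h'
        · exact hsymm _ _ (hfR (n + 1) (by omega) n hn (by omega) (by omega) (Or.inl hn2))
  · rintro ⟨n, hn⟩
    dsimp only
    by_cases h : 2 * (k / 2) ≤ n
    · exact Or.inr (Or.inr ⟨(hodd n hn h).1, hfq n h⟩)
    · rcases Nat.mod_two_eq_zero_or_one n with hn2 | hn2
      · exact Or.inl (by rw [hfa n (by omega) hn2]; exact ha _ (by omega))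
      · exact Or.inr (Or.inl (by rw [hfb n (by omega) hn2]; exact hb _ (by omega)))

end Cycle

/-! ### From forks and fans to polygons -/

theorem exists_branching {a b : List Bool} (hl : a.length = b.length) (hne : a ≠ b) :
    ∃ p c u v, a = p ++ c :: u ∧ b = p ++ (!c) :: v := by
  induction a generalizing b with
  | nil => exact absurd (List.length_eq_zero_iff.mp hl.symm).symm hne
  | cons x a ih =>
    obtain _ | ⟨y, b⟩ := b
    · simp at hl
    · by_cases hxy : x = y
      · subst hxy
        obtain ⟨p, c, u, v, rfl, rfl⟩ := ih (b := b) (by simpa using hl) (by simpa using hne)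
        exact ⟨x :: p, c, u, v, rfl, rfl⟩
      · exact ⟨[], x, a, b, rfl, by cases x <;> cases y <;> simp_all⟩

theorem embed_injOn_length (N : ℕ) : Set.InjOn embed {a | a.length = N} := by
  intro a ha b hb h
  by_contra hne
  obtain ⟨p, c, u, v, rfl, rfl⟩ := exists_branching (ha.trans hb.symm) hne
  have := wordDist_embed p u v c
  rw [h, wordDist_self] at this
  omega

theorem wordDist_embed_of_prefix {p a b : List Bool} {c : Bool} (ha : p ++ [c] <+: a)
    (hb : p ++ [!c] <+: b) :
    wordDist stdGens (embed a) (embed b) + 2 * p.length = a.length + b.length := by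
  obtain ⟨u, rfl⟩ := ha
  obtain ⟨v, rfl⟩ := hb
  have := wordDist_embed p u v c
  simp only [List.append_assoc, List.singleton_append, this, List.length_append, List.length_cons]
  omega

/-- A forked node, with an additional point if `k` is odd, yields a monochromatic polygon. -/
theorem exists_regularPolygon_of_forked {α : Type*} {color : Z2FreeProd → α} {k N : ℕ}
    (hk : 2 ≤ k) {p : List Bool} {i : α}
    (h : Forked (fun x => color (embed x)) (k / 2) N p i) (q : Z2FreeProd)
    (hq : Odd k → color q = i ∧ ∀ a, p <+: a → a.length = N →
      wordDist stdGens (embed a) q = 2 * (N - p.length)) :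
    ∃ g : Fin k → Z2FreeProd, IsRegularPolygon stdGens k g (2 * (N - p.length)) ∧
      ∀ j, color (g j) = i := by
  classical
  obtain ⟨⟨A, hA, hA'⟩, B, hB, hB'⟩ := h
  have hpN : p.length < N := by
    have : A.Nonempty := Finset.card_pos.mp (by omega)
    obtain ⟨a, ha⟩ := this
    have h₁ := (hA' a ha).1.length_le
    have h₂ := (hA' a ha).2.1
    simp at h₁
    omega
  have hcard {T : Finset (List Bool)} (hT : ∀ a ∈ T, a.length = N) :
      (T.image embed).card = T.card :=
    Finset.card_image_of_injOn fun a ha b hb hab =>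
      embed_injOn_length N (hT a ha) (hT b hb) hab
  obtain ⟨g, hinj, hR, hmem⟩ := exists_cycle
    (R := fun x y => wordDist stdGens x y = 2 * (N - p.length))
    (fun x y hxy => by rw [wordDist_comm, hxy])
    (fun x hx => by rw [wordDist_self] at hx; omega) hk
    (A := A.image embed) (B := B.image embed)
    (by rwa [hcard fun a ha => (hA' a ha).2.1]) (by rwa [hcard fun a ha => (hB' a ha).2.1])
    (by
      simp only [Finset.forall_mem_image]
      intro a ha b hb
      have := wordDist_embed_of_prefix (hA' a ha).1 (hB' b hb).1
      rw [(hA' a ha).2.1, (hB' b hb).2.1] at this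
      omega) q
    (by
      intro hodd
      simp only [Finset.forall_mem_image]
      exact ⟨fun a ha => (hq hodd).2 a ((List.prefix_append _ _).trans (hA' a ha).1) (hA' a ha).2.1,
        fun a ha => (hq hodd).2 a ((List.prefix_append _ _).trans (hB' a ha).1) (hB' a ha).2.1⟩)
  refine ⟨g, ⟨hinj, hR⟩, fun j => ?_⟩
  rcases hmem j with h | h | ⟨hodd, h⟩
  · obtain ⟨a, ha, h⟩ := Finset.mem_image.mp h
    rw [← h]
    exact (hA' a ha).2.2
  · obtain ⟨a, ha, h⟩ := Finset.mem_image.mp h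
    rw [← h]
    exact (hB' a ha).2.2
  · rw [h]
    exact (hq hodd).1

theorem exists_regularPolygon_of_hasFan {α : Type*} {color : Z2FreeProd → α} {k D : ℕ}
    (hk : 2 ≤ k) (h : HasFan (fun x => color (embed x)) (k / 2) D) :
    ∃ (g : Fin k → Z2FreeProd) (l : ℕ), IsRegularPolygon stdGens k g l ∧
      (∃ i, ∀ j, color (g j) = i) ∧ l ≤ D := by
  obtain ⟨i, N, p, z, b, q, hf, hc, hz, hl, hD⟩ := h
  obtain ⟨g, hg, hgi⟩ := exists_regularPolygon_of_forked hk hf (embed (z ++ b :: q)) fun _ =>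
    ⟨hc, fun a hpa haN => by
      have := wordDist_embed_of_prefix (b := z ++ b :: q) (hz.trans hpa) (by simp)
      have := hz.length_le
      simp only [List.length_append, List.length_cons, List.length_nil] at *
      omega⟩
  exact ⟨g, _, hg, ⟨i, hgi⟩, by omega⟩

theorem exists_regularPolygon_of_even {r k d : ℕ} (hk : 2 ≤ k) (heven : Even k)
    (hkd : k / 2 ≤ 2 ^ (d - 1)) (hd : 1 ≤ d) (color : Z2FreeProd → Fin r) :
    ∃ (g : Fin k → Z2FreeProd) (l : ℕ), IsRegularPolygon stdGens k g l ∧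
      (∃ i, ∀ j, color (g j) = i) ∧ l + 2 ≤ 4 * r + 2 * d := by
  -- The depth allows `r` levels for finding the fork and `r + (d - 1)` for the pigeonhole, as `r *
  -- (k / 2) ≤ 2 ^ r * 2 ^ (d - 1)`.
  obtain ⟨p, i, -, -, -, h⟩ := exists_forked (color := fun x => color (embed x)) (K := k / 2)
    (N := 2 * r + d - 1) (e := r + (d - 1)) (S := Finset.univ) (by simp)
    (by
      rw [Finset.card_fin, pow_add]
      exact Nat.mul_le_mul Nat.lt_two_pow_self.le hkd) [] (by simp; omega)
  obtain ⟨g, hg, hgi⟩ := exists_regularPolygon_of_forked hk h 1 fun hodd =>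
    absurd heven (Nat.not_even_iff_odd.mpr hodd)
  exact ⟨g, _, hg, ⟨i, hgi⟩, by omega⟩

/-! ### Comparison with the tower bounds -/

theorem le_four_pow (n : ℕ) : 4 * n ≤ 4 ^ n := by
  induction n with
  | zero => simp
  | succ n ih =>
    rw [pow_succ]
    have := Nat.one_le_pow n 4 (by norm_num)
    omega

theorem le_tower (n x : ℕ) : x ≤ tower n x := by
  induction n with
  | zero => rfl
  | succ n ih =>
    have := le_four_pow (tower n x)
    rw [tower]
    omega

theorem four_mul_le_tower {n : ℕ} (hn : n ≠ 0) (x : ℕ) : 4 * x ≤ tower n x := by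
  obtain _ | n := n
  · exact absurd rfl hn
  · have h₁ := le_tower n x
    have h₂ := le_four_pow (tower n x)
    rw [tower]
    omega

theorem tower_add (m n x : ℕ) : tower (m + n) x = tower m (tower n x) := by
  induction m with
  | zero => simp [tower]
  | succ m ih => rw [Nat.succ_add, tower, tower, ih]

theorem le_evenBound {d : ℕ} (hd : 2 ≤ d) (j : ℕ) :
    4 * (j + 2) + 2 * d ≤ evenBound (j + 2) d + 2 := by
  unfold evenBound
  simp only [Nat.add_sub_cancel]
  induction j with
  | zero =>
    simp only [pow_zero, tower]
    induction d, hd using Nat.le_induction with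
    | base => norm_num
    | succ d _ ih =>
      rw [pow_succ]
      omega
  | succ j ih =>
    have := four_mul_le_tower (n := 2 ^ j) (by positivity) (tower (2 ^ j) d)
    rw [pow_succ, mul_two, tower_add]
    omega

theorem succ_le_fanDepth (d R : ℕ) : R + 1 ≤ fanDepth d R ∧ (R ≠ 0 → d ≤ fanDepth d R) := by
  obtain _ | R := R
  · simp [fanDepth]
  · rw [fanDepth]
    omega

theorem fanDepth_le_oddBound {d : ℕ} (hd : 2 ≤ d) (j : ℕ) :
    4 * fanDepth d (j + 2) ≤ oddBound (j + 2) d := by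
  induction j with
  | zero =>
    simp only [oddBound, fanDepth, pow_zero, Nat.sub_self, tower]
    induction d, hd using Nat.le_induction with
    | base => norm_num
    | succ d _ ih =>
      rw [pow_succ]
      omega
  | succ j ih =>
    set x := oddBound (j + 2) d with hx
    -- The fours are discarded: the recursion for `fanDepth` grows at most cubically in `x`, so a
    -- single power of `64` suffices.
    have h₁ : 64 ^ x ≤ oddBound (j + 1 + 2) d := le_tower _ _
    refine le_trans ?_ h₁
    obtain ⟨h₂, h₃⟩ := succ_le_fanDepth d (j + 2)
    specialize h₃ (by omega)
    have h₄ : j + 3 ≤ x := by omega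
    have h₅ : (j + 3) ^ 2 * (4 * fanDepth d (j + 2)) ≤ x ^ 2 * x :=
      Nat.mul_le_mul (Nat.pow_le_pow_left h₄ 2) ih
    have h₆ : 4 * fanDepth d (j + 3) ≤ x ^ 3 + 4 * x := by
      rw [fanDepth]
      linarith
    have h₇ : x ≤ x ^ 3 := Nat.le_self_pow (by norm_num) x
    have h₈ : x ^ 3 ≤ 8 ^ x := by
      calc x ^ 3 ≤ (2 ^ x) ^ 3 := Nat.pow_le_pow_left Nat.lt_two_pow_self.le 3
        _ = 8 ^ x := by rw [← pow_mul, mul_comm, pow_mul]; norm_num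
    have h₉ : 8 ≤ 8 ^ x := Nat.le_self_pow (by omega) 8
    calc 4 * fanDepth d (j + 1 + 2) ≤ 8 * 8 ^ x := by
          change 4 * fanDepth d (j + 3) ≤ _
          omega
      _ ≤ 8 ^ x * 8 ^ x := Nat.mul_le_mul_right _ h₉
      _ = 64 ^ x := by rw [← mul_pow]; norm_num

end RegularPolygon

theorem theorem1 (r k d : ℕ) (hk : 1 ≤ k) (hd : 1 ≤ d) (hkd : k ≤ 2 ^ (d - 1))
    (color : RegularPolygon.Z2FreeProd → Fin r) :
    ∃ (g : Fin k → RegularPolygon.Z2FreeProd) (l : ℕ),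
      RegularPolygon.IsRegularPolygon RegularPolygon.stdGens k g l ∧
      (∃ a : Fin r, ∀ i : Fin k, color (g i) = a) ∧
      (2 ≤ r →
        (Even k → l ≤ RegularPolygon.evenBound r d) ∧
        (Odd k → l ≤ RegularPolygon.oddBound r d)) := by
  obtain rfl | hk : k = 1 ∨ 2 ≤ k := by omega
  · exact ⟨fun _ => 1, 0, ⟨fun _ _ _ => Subsingleton.elim _ _,
      fun _ => RegularPolygon.wordDist_self 1⟩, ⟨color 1, fun _ => rfl⟩, by simp⟩
  -- `d = 1` would force `k = 1`; the numerical estimates start at `d = 2`.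
  have hd : 2 ≤ d := by
    by_contra h
    obtain rfl : d = 1 := by omega
    simp at hkd
    omega
  rcases Nat.even_or_odd k with heven | hodd
  · obtain ⟨g, l, hg, hc, hl⟩ :=
      RegularPolygon.exists_regularPolygon_of_even (d := d) hk heven (by omega) (by omega) color
    refine ⟨g, l, hg, hc, fun hr => ⟨fun _ => ?_, fun h =>
      absurd heven (Nat.not_even_iff_odd.mpr h)⟩⟩
    obtain ⟨j, rfl⟩ := Nat.exists_eq_add_of_le' hr
    have := RegularPolygon.le_evenBound hd j
    omega
  · have hK : k / 2 ≤ 2 ^ d := by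
      have := Nat.pow_le_pow_right (n := 2) (by norm_num) (Nat.sub_le d 1)
      omega
    obtain ⟨g, l, hg, hc, hl⟩ := RegularPolygon.exists_regularPolygon_of_hasFan hk
      (RegularPolygon.exists_fan hK r Finset.univ
        (fun x => color (RegularPolygon.embed x)) (by simp) (by simp))
    refine ⟨g, l, hg, hc, fun hr => ⟨fun h => absurd h (Nat.not_even_iff_odd.mpr hodd),
      fun _ => ?_⟩⟩
    obtain ⟨j, rfl⟩ := Nat.exists_eq_add_of_le' hr
    exact hl.trans (RegularPolygon.fanDepth_le_oddBound hd j)
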